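/- Let $K$ be a field of characteristic zero and let $[1,n]=I_1\sqcup\dots\sqcup I_\ell$ be an arbitrary partition of $\{1,\dots,n\}$ into consecutive non-empty segments. Let $P\subseteq \mathrm{GL}(n)=\mathrm{GL}(n,K)$ be the corresponding standard parabolic subgroup (every parabolic subgroup of $\mathrm{GL}(n)$ is conjugate to one of these), and let $U$ be its unipotent radical, i.e. the group of all matrices $E+A$ where $E$ is the identity matrix and $A_{ij}=0$ unless $i\in I_k$, $j\in I_m$ with $k<m$. The group $U$ acts on the field $\mathcal F=K(\mathrm{GL}(n))=K(x_{ij}: 1\le i,j\le n)$ of rational functions on $\mathrm{GL}(n)$ by $(\rho(g)f)(x)=f(g^{-1}xg)$; let $\mathcal F^U$ be the field of invariants. Put $i'=n+1-i$ and let $\mathbb S$ be the set of pairs $(i,j)$ such that, if $i\in I_k$ and $j'\in I_m$, then $k\ge m$. Let $X=(x_{ij})$ be the matrix of coordinate functions and let $X^*$ be its adjugate, so $XX^*=X^*X=\det(X)E$. For $(i,j)\in\mathbb S$ define $J_{ij}\in K[x_{st}: 1\le s,t\le n]$ as follows. - If $i+j\le n+1$ (the pair lies on or above the anti-diagonal),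 $J_{ij}$ is the minor of $X$ with columns $1,\dots,j$ and rows $\{i\}\cup\{j'+1,\dots,n\}$. - If $i+j>n+1$ (the pair lies strictly below the anti-diagonal), $J_{ij}$ is the determinant of the $j\times j$ matrix whose first $i'$ rows are the last $i'$ rows of $X$ and whose remaining $j-i'$ rows are the last $j-i'$ rows of $X^*$ (each kept in its order), all restricted to the columns $1,\dots,j$. Theorem. The polynomials $J_{ij}$, $(i,j)\in\mathbb S$, freely generate the field $\mathcal F^U$ over $K$: they are algebraically independent over $K$, and $\mathcal F^U=K(J_{ij}:(i,j)\in\mathbb S)$. -/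

import Mathlib

namespace ParabolicInvariants

open MvPolynomial

/-- The unipotent radical of the standard parabolic subgroup of `GL(n)` attached to a composition
`c` of `n`.  The blocks of `c` are the consecutive segments `I_1, …, I_ℓ` of the index set, and
`c.index i` is the number of the segment that contains `i`.  The elements are the matrices `1 + A`
with `A i j = 0` unless the segment of `i` strictly precedes that of `j`. -/
def unipotentRadical {n : ℕ} (c : Composition n) (K : Type*) [Field K] :
    Subgroup (Matrix.GeneralLinearGroup (Fin n) K) where
  carrier := {g | ∀ i j, c.index j ≤ c.index i →
    (g : Matrix (Fin n) (Fin n) K) i j = (1 : Matrix (Fin n) (Fin n) K) i j}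
  one_mem' := by
    intro i j _
    rfl
  mul_mem' := by
    intro g h hg hh i j hij
    have key : ∀ k, (g : Matrix (Fin n) (Fin n) K) i k * (h : Matrix (Fin n) (Fin n) K) k j =
        (1 : Matrix (Fin n) (Fin n) K) i k * (1 : Matrix (Fin n) (Fin n) K) k j := by
      intro k
      rcases le_or_gt (c.index k) (c.index i) with hk | hk
      · rw [hg i k hk]
        by_cases hik : i = k
        · subst hik
          rw [hh i j hij]
        · simp [Matrix.one_apply_ne hik]
      · rw [hh k j (hij.trans hk.le)]
        have hkj : k ≠ j := by
          rintro rfl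
          exact absurd hij (not_le.mpr hk)
        simp [Matrix.one_apply_ne hkj]
    rw [Units.val_mul, Matrix.mul_apply, Finset.sum_congr rfl fun k _ => key k,
      ← Matrix.mul_apply, one_mul]
  inv_mem' := by
    intro g hg i j hij
    have hbt : Matrix.BlockTriangular (g : Matrix (Fin n) (Fin n) K) c.index := by
      intro a b hab
      rw [hg a b hab.le, Matrix.one_apply_ne]
      rintro rfl
      exact lt_irrefl _ hab
    have hinv : Matrix.BlockTriangular ((g⁻¹ : Matrix.GeneralLinearGroup (Fin n) K) :
        Matrix (Fin n) (Fin n) K) c.index := by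
      have : Invertible (g : Matrix (Fin n) (Fin n) K) := Units.invertible g
      rw [Matrix.coe_units_inv]
      exact Matrix.blockTriangular_inv_of_blockTriangular hbt
    have key : ∀ k, ((g⁻¹ : Matrix.GeneralLinearGroup (Fin n) K) : Matrix (Fin n) (Fin n) K) i k *
        (g : Matrix (Fin n) (Fin n) K) k j =
        ((g⁻¹ : Matrix.GeneralLinearGroup (Fin n) K) : Matrix (Fin n) (Fin n) K) i k *
        (1 : Matrix (Fin n) (Fin n) K) k j := by
      intro k
      rcases lt_or_ge (c.index k) (c.index i) with hk | hk
      · rw [hinv hk, zero_mul, zero_mul]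
      · rw [hg k j (hij.trans hk)]
    have h1 : ((g⁻¹ : Matrix.GeneralLinearGroup (Fin n) K) : Matrix (Fin n) (Fin n) K) *
        (g : Matrix (Fin n) (Fin n) K) = 1 := by
      rw [← Units.val_mul, inv_mul_cancel, Units.val_one]
    rw [← h1, Matrix.mul_apply, Finset.sum_congr rfl fun k _ => key k, ← Matrix.mul_apply, mul_one]

/-- The generic matrix `X = (x_{ij})`, whose entries are the coordinate functions on `Mat(n)`. -/
noncomputable abbrev genericMatrix (n : ℕ) (K : Type*) [Field K] :
    Matrix (Fin n) (Fin n) (MvPolynomial (Fin n × Fin n) K) :=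
  Matrix.mvPolynomialX (Fin n) (Fin n) K

/-- The field `K(GL(n))` of rational functions on `GL(n)`.  The coordinate ring of `GL(n)` is
the polynomial ring `K[x_{ij}]` localized at `det X`, hence its field of fractions is the field
of fractions of the polynomial ring. -/
abbrev RationalFunctions (n : ℕ) (K : Type*) [Field K] : Type _ :=
  FractionRing (MvPolynomial (Fin n × Fin n) K)

/-- The generic point of `GL(n)` moved by `g`: the matrix `g⁻¹ X g`. -/
noncomputable def conjGeneric {n : ℕ} {K : Type*} [Field K]
    (g : Matrix.GeneralLinearGroup (Fin n) K) :
    Matrix (Fin n) (Fin n) (MvPolynomial (Fin n × Fin n) K) :=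
  ((g⁻¹ : Matrix.GeneralLinearGroup (Fin n) K) : Matrix (Fin n) (Fin n) K).map C *
    genericMatrix n K * (g : Matrix (Fin n) (Fin n) K).map C

/-- The substitution `f(x) ↦ f(g⁻¹ x g)` on polynomial functions. -/
noncomputable def conjHom {n : ℕ} {K : Type*} [Field K]
    (g : Matrix.GeneralLinearGroup (Fin n) K) :
    MvPolynomial (Fin n × Fin n) K →ₐ[K] MvPolynomial (Fin n × Fin n) K :=
  aeval fun p => conjGeneric g p.1 p.2

theorem map_conjHom_genericMatrix {n : ℕ} {K : Type*} [Field K]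
    (g : Matrix.GeneralLinearGroup (Fin n) K) :
    (genericMatrix n K).map (conjHom g) = conjGeneric g := by
  ext1 i j
  simp [conjHom, Matrix.mvPolynomialX_apply]

theorem map_conjHom_C {n : ℕ} {K : Type*} [Field K]
    (g : Matrix.GeneralLinearGroup (Fin n) K) (A : Matrix (Fin n) (Fin n) K) :
    (A.map C).map (conjHom g) = A.map C := by
  ext1 i j
  simp only [Matrix.map_apply]
  exact (conjHom g).commutes (A i j)

theorem map_conjHom_conjGeneric {n : ℕ} {K : Type*} [Field K]
    (g h : Matrix.GeneralLinearGroup (Fin n) K) :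
    (conjGeneric h).map (conjHom g) = conjGeneric (g * h) := by
  rw [conjGeneric, Matrix.map_mul, Matrix.map_mul, map_conjHom_C, map_conjHom_C,
    map_conjHom_genericMatrix, conjGeneric, conjGeneric, mul_inv_rev, Units.val_mul,
    Units.val_mul, Matrix.map_mul, Matrix.map_mul]
  simp only [Matrix.mul_assoc]

theorem conjHom_mul {n : ℕ} {K : Type*} [Field K] (g h : Matrix.GeneralLinearGroup (Fin n) K) :
    conjHom (g * h) = (conjHom g).comp (conjHom h) := by
  apply MvPolynomial.algHom_ext
  rintro ⟨i, j⟩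
  have h1 := congrFun (congrFun (map_conjHom_conjGeneric g h) i) j
  rw [AlgHom.comp_apply]
  simpa [conjHom] using h1.symm

theorem conjHom_one {n : ℕ} {K : Type*} [Field K] :
    conjHom (1 : Matrix.GeneralLinearGroup (Fin n) K) = AlgHom.id K _ := by
  apply MvPolynomial.algHom_ext
  rintro ⟨i, j⟩
  have h1 : (1 : Matrix (Fin n) (Fin n) K).map (C : K →+* MvPolynomial (Fin n × Fin n) K) = 1 :=
    Matrix.map_one _ C.map_zero C.map_one
  simp [conjHom, conjGeneric, h1]

/-- The representation `ρ(g) f(x) = f(g⁻¹ x g)` of `GL(n)` on polynomial functions. -/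
noncomputable def conjPoly (n : ℕ) (K : Type*) [Field K] :
    Matrix.GeneralLinearGroup (Fin n) K →*
      (MvPolynomial (Fin n × Fin n) K ≃ₐ[K] MvPolynomial (Fin n × Fin n) K) where
  toFun g := AlgEquiv.ofAlgHom (conjHom g) (conjHom g⁻¹)
    (by rw [← conjHom_mul, mul_inv_cancel, conjHom_one])
    (by rw [← conjHom_mul, inv_mul_cancel, conjHom_one])
  map_one' := by
    ext1 f
    simp [conjHom_one]
  map_mul' g h := by
    ext1 f
    simp [conjHom_mul]

/-- The extension of the action `ρ(g) f(x) = f(g⁻¹ x g)` to rational functions on `GL(n)`. -/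
noncomputable def conjRational (n : ℕ) (K : Type*) [Field K] :
    Matrix.GeneralLinearGroup (Fin n) K →*
      (RationalFunctions n K ≃ₐ[K] RationalFunctions n K) :=
  (IsFractionRing.fieldEquivOfAlgEquivHom K (RationalFunctions n K)).comp (conjPoly n K)

/-- The field of invariant rational functions on `GL(n)` under conjugation by the unipotent
radical attached to `c`. -/
noncomputable def invariantField {n : ℕ} (c : Composition n) (K : Type*) [Field K] :
    IntermediateField K (RationalFunctions n K) :=
  IntermediateField.fixedField ((unipotentRadical c K).map (conjRational n K))

/-- The set of pairs `(i, j)` such that the segment of `i` is not before the segment of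
`j' = Fin.rev j`; that is, `i ∈ I_k` and `j ∈ I_m'` with `k ≥ m`. -/
def indexSet {n : ℕ} (c : Composition n) : Set (Fin n × Fin n) :=
  {p | c.index p.2.rev ≤ c.index p.1}

theorem rev_add_lt {n : ℕ} (j : Fin n) (r : Fin (j + 1)) : (j.rev : ℕ) + r < n := by
  have := Fin.val_rev j
  omega

/-- The row of index `j' + r`, for `0 ≤ r ≤ j`, where `j' = Fin.rev j`.  The row with `r = j` is
the last one, of index `n - 1`. -/
def rowFromRev {n : ℕ} (j : Fin n) (r : Fin (j + 1)) : Fin n :=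
  ⟨j.rev + r, rev_add_lt j r⟩

/-- The column of index `t`, for `0 ≤ t ≤ j`. -/
def initialColumn {n : ℕ} (j : Fin n) (t : Fin (j + 1)) : Fin n :=
  Fin.castLE j.isLt t

/-- The minor of `X` with the first columns up to and including `j`, and with the row `i`
followed by all the rows strictly after `j'`. -/
noncomputable def upperDet {n : ℕ} (K : Type*) [Field K] (i j : Fin n) :
    MvPolynomial (Fin n × Fin n) K :=
  (Matrix.of fun r t : Fin (j + 1) =>
    genericMatrix n K (if r = 0 then i else rowFromRev j r) (initialColumn j t)).det

/-- The determinant with the columns up to and including `j` of the rows `i, …, n - 1` of `X` (the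
last `n - i` rows), followed by the last `(j + 1) - (n - i)` rows of the adjugate matrix `X*`.
For `r ≥ n - i`, the `r`-th row comes from the row `j' + r` of `X*`. -/
noncomputable def lowerDet {n : ℕ} (K : Type*) [Field K] (i j : Fin n) :
    MvPolynomial (Fin n × Fin n) K :=
  (Matrix.of fun r t : Fin (j + 1) =>
    if h : (i : ℕ) + r < n then genericMatrix n K ⟨i + r, h⟩ (initialColumn j t)
    else (genericMatrix n K).adjugate (rowFromRev j r) (initialColumn j t)).det

/-- The determinant `J_{ij}`: a minor of `X` if `(i, j)` lies on or above the anti-diagonal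
(`i ≤ j'`), a mixed determinant of `X` and `X*` if it lies strictly below. -/
noncomputable def J {n : ℕ} (K : Type*) [Field K] (i j : Fin n) :
    MvPolynomial (Fin n × Fin n) K :=
  if i ≤ j.rev then upperDet K i j else lowerDet K i j

end ParabolicInvariants

namespace ParabolicInvariants

open MvPolynomial

section Minors

variable {R : Type*} {n : ℕ}

/-- The matrix whose rows are the rows `i, …, n - 1` of `A` followed by the last rows of `B`, with
the columns up to and including `j`. -/
def mixedMatrix (A B : Matrix (Fin n) (Fin n) R) (i j : Fin n) :
    Matrix (Fin (j + 1)) (Fin (j + 1)) R :=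
  Matrix.of fun r t => if h : (i : ℕ) + r < n then A ⟨i + r, h⟩ (initialColumn j t)
    else B (rowFromRev j r) (initialColumn j t)

/-- The submatrix of `A` with the row `i` followed by the rows after `j'`, and with the columns
up to and including `j`. -/
def upperMatrix (A : Matrix (Fin n) (Fin n) R) (i j : Fin n) :
    Matrix (Fin (j + 1)) (Fin (j + 1)) R :=
  Matrix.of fun r t => A (if r = 0 then i else rowFromRev j r) (initialColumn j t)

/-- The rows of `mixedMatrix`. -/
def mixedRow (i j : Fin n) (r : Fin (j + 1)) : Fin n ⊕ Fin n :=
  if h : (i : ℕ) + r < n then Sum.inl ⟨i + r, h⟩ else Sum.inr (rowFromRev j r)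

theorem mixedMatrix_eq_submatrix (A B : Matrix (Fin n) (Fin n) R) (i j : Fin n) :
    mixedMatrix A B i j = (Matrix.fromRows A B).submatrix (mixedRow i j) (initialColumn j) := by
  ext r t
  by_cases h : (i : ℕ) + r < n <;> simp [mixedMatrix, mixedRow, h]

theorem upperMatrix_rev (A B : Matrix (Fin n) (Fin n) R) (q : Fin n) :
    upperMatrix A q q.rev = mixedMatrix A B q q.rev := by
  have hv := Fin.val_rev q
  ext r t
  have hr := r.isLt
  have h : (q : ℕ) + r < n := by omega
  simp only [upperMatrix, mixedMatrix, Matrix.of_apply, h, dite_true]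
  congr 1
  split_ifs with h0
  · simp [h0]
  · simp [rowFromRev]

theorem cofactor_mixedMatrix_succ (A B : Matrix (Fin n) (Fin n) R) {i j : ℕ} (hi : i + 1 < n)
    (hj : j + 1 < n) :
    (mixedMatrix A B ⟨i, by omega⟩ ⟨j + 1, hj⟩).submatrix Fin.succ Fin.castSucc =
      mixedMatrix A B ⟨i + 1, hi⟩ ⟨j, by omega⟩ := by
  ext r t
  have e : i + (r + 1) = i + 1 + r := by omega
  simp only [mixedMatrix, Matrix.submatrix_apply, Matrix.of_apply, Fin.val_succ, e]
  split_ifs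
  · rfl
  · congr 1
    ext
    simp only [rowFromRev, Fin.val_rev, Fin.val_succ]
    omega

theorem mixedMatrix_eq_of_rev_eq (A B C : Matrix (Fin n) (Fin n) R) {i j : Fin n}
    (hij : j.rev = i) : mixedMatrix A B i j = mixedMatrix A C i j := by
  subst hij
  have h := upperMatrix_rev A B j.rev
  have h' := upperMatrix_rev A C j.rev
  rw [Fin.rev_rev] at h h'
  rw [← h, ← h']

theorem mixedMatrix_zero_last (A B : Matrix (Fin n) (Fin n) R) (i j : Fin n) :
    mixedMatrix A B i j 0 (Fin.last j) = A i j := by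
  have h : (i : ℕ) + (0 : Fin (j + 1)) < n := by simp
  simp only [mixedMatrix, Matrix.of_apply, h, dite_true]
  congr 1

end Minors

section Triangular

variable {R : Type*} [CommRing R] {n : ℕ}

/-- The matrices `1 + A` with `A i j = 0` unless `b i < b j`. -/
def IsBlockUnipotent {ι : Type*} [LinearOrder ι] (b : Fin n → ι)
    (g : Matrix (Fin n) (Fin n) R) : Prop :=
  ∀ i j, b j ≤ b i → g i j = (1 : Matrix (Fin n) (Fin n) R) i j

namespace IsBlockUnipotent

variable {ι : Type*} [LinearOrder ι] {b : Fin n → ι} {g h : Matrix (Fin n) (Fin n) R}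

theorem blockTriangular (hg : IsBlockUnipotent b g) : g.BlockTriangular b := by
  intro i j hij
  rw [hg i j hij.le, Matrix.one_apply_ne]
  rintro rfl
  exact lt_irrefl _ hij

theorem diag (hg : IsBlockUnipotent b g) (i : Fin n) : g i i = 1 := by
  rw [hg i i le_rfl, Matrix.one_apply_eq]

theorem to_id (hg : IsBlockUnipotent b g) (hb : Monotone b) :
    IsBlockUnipotent (id : Fin n → Fin n) g :=
  fun i j hij => hg i j (hb hij)

theorem det_eq_one (hg : IsBlockUnipotent b g) (hb : Monotone b) : g.det = 1 := by
  rw [Matrix.det_of_isUpperTriangular (hg.to_id hb).blockTriangular]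
  exact Finset.prod_eq_one fun i _ => hg.diag i

theorem mul (hg : IsBlockUnipotent b g) (hh : IsBlockUnipotent b h) :
    IsBlockUnipotent b (g * h) := by
  intro i j hij
  have key : ∀ k, g i k * h k j =
      (1 : Matrix (Fin n) (Fin n) R) i k * (1 : Matrix (Fin n) (Fin n) R) k j := by
    intro k
    rcases le_or_gt (b k) (b i) with hk | hk
    · rw [hg i k hk]
      by_cases hik : i = k
      · subst hik
        rw [hh i j hij]
      · simp [Matrix.one_apply_ne hik]
    · rw [hh k j (hij.trans hk.le)]
      have hkj : k ≠ j := by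
        rintro rfl
        exact absurd hij (not_le.mpr hk)
      simp [Matrix.one_apply_ne hkj]
  rw [Matrix.mul_apply, Finset.sum_congr rfl fun k _ => key k, ← Matrix.mul_apply, one_mul]

theorem inv (hg : IsBlockUnipotent b g) (hb : Monotone b) : IsBlockUnipotent b g⁻¹ := by
  have hdet : IsUnit g.det := by rw [hg.det_eq_one hb]; exact isUnit_one
  have hinv : g⁻¹.BlockTriangular b := by
    have := g.invertibleOfIsUnitDet hdet
    exact Matrix.blockTriangular_inv_of_blockTriangular hg.blockTriangular
  intro i j hij
  have key : ∀ k, g⁻¹ i k * g k j = g⁻¹ i k * (1 : Matrix (Fin n) (Fin n) R) k j := by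
    intro k
    rcases lt_or_ge (b k) (b i) with hk | hk
    · rw [hinv hk, zero_mul, zero_mul]
    · rw [hg k j (hij.trans hk)]
  have h1 : g⁻¹ * g = 1 := Matrix.nonsing_inv_mul g hdet
  rw [← h1, Matrix.mul_apply, Finset.sum_congr rfl fun k _ => key k, ← Matrix.mul_apply, mul_one]

theorem adjugate_eq (hg : IsBlockUnipotent b g) (hb : Monotone b) : g.adjugate = g⁻¹ := by
  rw [Matrix.inv_def, hg.det_eq_one hb, Ring.inverse_one, one_smul]

theorem mul_inv (hg : IsBlockUnipotent b g) (hb : Monotone b) : g * g⁻¹ = 1 :=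
  Matrix.mul_nonsing_inv g (by rw [hg.det_eq_one hb]; exact isUnit_one)

theorem inv_mul (hg : IsBlockUnipotent b g) (hb : Monotone b) : g⁻¹ * g = 1 :=
  Matrix.nonsing_inv_mul g (by rw [hg.det_eq_one hb]; exact isUnit_one)

theorem adjugate_conj (hg : IsBlockUnipotent b g) (hb : Monotone b)
    (A : Matrix (Fin n) (Fin n) R) : (g⁻¹ * A * g).adjugate = g⁻¹ * A.adjugate * g := by
  have h2 : g⁻¹.adjugate = g := by
    rw [(hg.inv hb).adjugate_eq hb,
      Matrix.nonsing_inv_nonsing_inv g (by rw [hg.det_eq_one hb]; exact isUnit_one)]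
  rw [Matrix.adjugate_mul_distrib, Matrix.adjugate_mul_distrib, h2, hg.adjugate_eq hb,
    Matrix.mul_assoc]

theorem det_conj (hg : IsBlockUnipotent b g) (hb : Monotone b)
    (A : Matrix (Fin n) (Fin n) R) : (g⁻¹ * A * g).det = A.det := by
  rw [Matrix.det_mul, Matrix.det_mul, (hg.inv hb).det_eq_one hb, hg.det_eq_one hb, one_mul, mul_one]

end IsBlockUnipotent

/-- A square submatrix of `H * Q * g` factors when its set of rows is stable under `H` and its set
of columns is stable under `g`. -/
theorem submatrix_mul_mul {m ι : Type*} [Fintype m] [Fintype ι] {k : Type*} [Fintype k]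
    (H : Matrix m m R) (Q : Matrix m k R) (g : Matrix k k R) {ρ : ι → m} {c : ι → k}
    (hρ : Function.Injective ρ) (hc : Function.Injective c)
    (hH : ∀ r, ∀ a ∉ Set.range ρ, H (ρ r) a = 0) (hg : ∀ t, ∀ a ∉ Set.range c, g a (c t) = 0) :
    (H * Q * g).submatrix ρ c = H.submatrix ρ ρ * Q.submatrix ρ c * g.submatrix c c := by
  ext r t
  simp only [Matrix.submatrix_apply, Matrix.mul_apply]
  symm
  refine Fintype.sum_of_injective c hc _ _ (fun a ha => by rw [hg t a ha, mul_zero]) fun s => ?_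
  congr 1
  exact Fintype.sum_of_injective ρ hρ _ _ (fun a ha => by rw [hH r a ha, zero_mul]) fun s => rfl

theorem initialColumn_injective (j : Fin n) : Function.Injective (initialColumn j) :=
  Fin.castLE_injective j.isLt

theorem initialColumn_closed {g : Matrix (Fin n) (Fin n) R}
    (hg : g.BlockTriangular (id : Fin n → Fin n)) (j : Fin n) (t : Fin (j + 1)) (a : Fin n)
    (ha : a ∉ Set.range (initialColumn j)) : g a (initialColumn j t) = 0 := by
  apply hg
  by_contra hlt
  apply ha
  have h1 : (a : ℕ) ≤ t := by
    simpa [initialColumn, Fin.le_def] using hlt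
  exact ⟨⟨a, by omega⟩, by ext; simp [initialColumn]⟩

theorem det_initialColumn {g : Matrix (Fin n) (Fin n) R}
    (hg : IsBlockUnipotent (id : Fin n → Fin n) g) (j : Fin n) :
    (g.submatrix (initialColumn j) (initialColumn j)).det = 1 := by
  rw [Matrix.det_of_isUpperTriangular]
  · exact Finset.prod_eq_one fun i _ => hg.diag _
  · intro r t hrt
    exact hg.blockTriangular (show initialColumn j t < initialColumn j r from hrt)

theorem mixedRow_injective (i j : Fin n) : Function.Injective (mixedRow i j) := by
  intro r s hrs
  unfold mixedRow at hrs
  ext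
  split_ifs at hrs with h1 h2 h2 <;> simp [rowFromRev] at hrs <;> omega

theorem det_mixedMatrix_mul {h k A B g : Matrix (Fin n) (Fin n) R}
    (hh : h.BlockTriangular (id : Fin n → Fin n)) (hk : k.BlockTriangular (id : Fin n → Fin n))
    (hg : IsBlockUnipotent (id : Fin n → Fin n) g) {i j : Fin n} (hij : j.rev ≤ i) :
    (mixedMatrix (h * A * g) (k * B * g) i j).det =
      (∏ r : Fin (j + 1), if hr : (i : ℕ) + r < n then h ⟨i + r, hr⟩ ⟨i + r, hr⟩
        else k (rowFromRev j r) (rowFromRev j r)) * (mixedMatrix A B i j).det := by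
  have hij' : n - (j + 1) ≤ (i : ℕ) := by simpa [Fin.le_def, Fin.val_rev] using hij
  have e : Matrix.fromRows (h * A * g) (k * B * g) =
      Matrix.fromBlocks h 0 0 k * Matrix.fromRows A B * g := by
    rw [Matrix.fromBlocks_mul_fromRows, Matrix.fromRows_mul]
    simp
  rw [mixedMatrix_eq_submatrix, e, submatrix_mul_mul _ _ _ (mixedRow_injective i j)
    (initialColumn_injective j), Matrix.det_mul, Matrix.det_mul, det_initialColumn hg, mul_one,
    ← mixedMatrix_eq_submatrix, Matrix.det_of_isUpperTriangular]
  · congr 1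
    refine Finset.prod_congr rfl fun r _ => ?_
    by_cases hr : (i : ℕ) + r < n <;> simp [mixedRow, hr]
  · intro r s hrs
    have hrs' : (s : ℕ) < r := hrs
    rw [Matrix.submatrix_apply]
    unfold mixedRow
    split_ifs with h1 h2 h2
    · exact hh (Fin.mk_lt_mk.2 (Nat.add_lt_add_left hrs' _))
    · rfl
    · rfl
    · exact hk (Fin.mk_lt_mk.2 (Nat.add_lt_add_left hrs' _))
  · intro r a ha
    by_cases h1 : (i : ℕ) + r < n
    · rcases a with a | a
      · simp only [mixedRow, h1, dite_true, Matrix.fromBlocks_apply₁₁]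
        apply hh
        by_contra hlt
        have hlt' : (i : ℕ) + r ≤ a := by simpa [Fin.le_def] using hlt
        apply ha
        have := a.isLt
        refine ⟨⟨a - i, by omega⟩, ?_⟩
        have h3 : (i : ℕ) + (a - i) = a := by omega
        simp [mixedRow, h3]
      · simp [mixedRow, h1]
    · rcases a with a | a
      · simp [mixedRow, h1]
      · simp only [mixedRow, h1, dite_false, Matrix.fromBlocks_apply₂₂]
        apply hk
        by_contra hlt
        have hlt' : (j.rev : ℕ) + r ≤ a := by simpa [Fin.le_def, rowFromRev] using hlt
        have hv := Fin.val_rev j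
        have hr := r.isLt
        apply ha
        have := a.isLt
        refine ⟨⟨a - j.rev, by omega⟩, ?_⟩
        have h3 : (j.rev : ℕ) + (a - j.rev) = a := by omega
        have h4 : ¬ (i : ℕ) + (a - j.rev) < n := by omega
        rw [mixedRow, dif_neg h4]
        simp only [rowFromRev, h3]
  · exact initialColumn_closed hg.blockTriangular j

theorem det_mixedMatrix_conj {g : Matrix (Fin n) (Fin n) R}
    (hg : IsBlockUnipotent (id : Fin n → Fin n) g) (A : Matrix (Fin n) (Fin n) R) {i j : Fin n}
    (hij : j.rev ≤ i) :
    (mixedMatrix (g⁻¹ * A * g) (g⁻¹ * A * g).adjugate i j).det =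
      (mixedMatrix A A.adjugate i j).det := by
  have hgi := hg.inv monotone_id
  rw [hg.adjugate_conj monotone_id, det_mixedMatrix_mul hgi.blockTriangular hgi.blockTriangular
    hg hij, Finset.prod_eq_one, one_mul]
  intro r _
  split_ifs
  · exact hgi.diag _
  · exact hgi.diag _

theorem det_upperMatrix_conj {ι : Type*} [LinearOrder ι] {b : Fin n → ι} (hb : Monotone b)
    {g : Matrix (Fin n) (Fin n) R} (hg : IsBlockUnipotent b g) (A : Matrix (Fin n) (Fin n) R)
    {i j : Fin n} (hij : i ≤ j.rev) (hbij : b j.rev ≤ b i) :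
    (upperMatrix (g⁻¹ * A * g) i j).det = (upperMatrix A i j).det := by
  have hgi := hg.inv hb
  have hv := Fin.val_rev j
  have hij' : (i : ℕ) ≤ j.rev := hij
  have e : ∀ B : Matrix (Fin n) (Fin n) R, upperMatrix B i j =
    B.submatrix (fun r => if r = 0 then i else rowFromRev j r) (initialColumn j) := fun _ => rfl
  have hpos : ∀ r : Fin (j + 1), r ≠ 0 → 0 < (r : ℕ) := fun r hr =>
    Nat.pos_of_ne_zero fun h => hr (Fin.ext h)
  rw [e, e, submatrix_mul_mul, Matrix.det_mul, Matrix.det_mul, det_initialColumn (hg.to_id hb),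
    mul_one, Matrix.det_of_isUpperTriangular, Finset.prod_eq_one, one_mul]
  · intro r _
    exact hgi.diag _
  · intro r s hrs
    have hrs' : (s : ℕ) < r := hrs
    have hr0 : r ≠ 0 := fun h => by simp [h] at hrs'
    apply (hgi.to_id hb).blockTriangular
    simp only [hr0, if_false, id]
    split_ifs
    · simp only [Fin.lt_def, rowFromRev]
      omega
    · simp only [Fin.lt_def, rowFromRev]
      omega
  · intro r s hrs
    simp only at hrs
    split_ifs at hrs with h1 h2 h2
    · rw [h1, h2]
    · have := hpos s h2
      have := congrArg Fin.val hrs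
      simp only [rowFromRev] at this
      omega
    · have := hpos r h1
      have := congrArg Fin.val hrs
      simp only [rowFromRev] at this
      omega
    · have := congrArg Fin.val hrs
      simp only [rowFromRev] at this
      ext
      omega
  · exact initialColumn_injective j
  · intro r a ha
    have key : a ≤ j.rev := by
      by_contra hlt
      have hlt' : (j.rev : ℕ) < a := by simpa [Fin.lt_def] using hlt
      apply ha
      have := a.isLt
      refine ⟨⟨a - j.rev, by omega⟩, ?_⟩
      have h3 : (⟨a - j.rev, by omega⟩ : Fin (j + 1)) ≠ 0 := by
        intro h
        have := congrArg Fin.val h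
        simp only [Fin.val_zero] at this
        omega
      have h4 : (j.rev : ℕ) + (a - j.rev) = a := by omega
      simp only [h3, if_false, rowFromRev, h4]
    have hne : a ≠ (if r = 0 then i else rowFromRev j r) := by
      rintro rfl
      exact ha ⟨r, rfl⟩
    rw [hgi _ _ ?_, Matrix.one_apply_ne hne.symm]
    split_ifs
    · exact (hb key).trans hbij
    · apply hb
      refine key.trans ?_
      simp only [Fin.le_def, rowFromRev]
      omega
  · exact initialColumn_closed (hg.to_id hb).blockTriangular j

theorem det_upperMatrix_eq_zero (A : Matrix (Fin n) (Fin n) R) {i j : Fin n} (hij : j.rev < i) :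
    (upperMatrix A i j).det = 0 := by
  have hv := Fin.val_rev j
  have hi := i.isLt
  have hij' : (j.rev : ℕ) < i := hij
  have h3 : (⟨i - j.rev, by omega⟩ : Fin (j + 1)) ≠ 0 := by
    intro h
    have := congrArg Fin.val h
    simp only [Fin.val_zero] at this
    omega
  refine Matrix.det_zero_of_row_eq h3.symm ?_
  ext t
  have h4 : (j.rev : ℕ) + (i - j.rev) = i := by omega
  simp only [upperMatrix, Matrix.of_apply, h3, if_true, if_false, rowFromRev, h4]

theorem mixedMatrix_map {S : Type*} [CommRing S] (f : R →+* S)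
    (A : Matrix (Fin n) (Fin n) R) (i j : Fin n) :
    f (mixedMatrix A A.adjugate i j).det = (mixedMatrix (A.map f) (A.map f).adjugate i j).det := by
  rw [RingHom.map_det]
  congr 1
  have := RingHom.map_adjugate f A
  simp only [RingHom.mapMatrix_apply] at this
  rw [← this]
  ext r t
  simp only [mixedMatrix, RingHom.mapMatrix_apply, Matrix.map_apply, Matrix.of_apply]
  split_ifs <;> rfl

theorem upperMatrix_map {S : Type*} [CommRing S] (f : R →+* S)
    (A : Matrix (Fin n) (Fin n) R) (i j : Fin n) :
    f (upperMatrix A i j).det = (upperMatrix (A.map f) i j).det := by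
  rw [RingHom.map_det]
  rfl

end Triangular

section AntiTriangular

variable {F : Type*} [Field F] {n : ℕ}

theorem det_ne_zero_of_antiTriangular {m : ℕ} {M : Matrix (Fin m) (Fin m) F}
    (h0 : ∀ r c : Fin m, r.rev < c → M r c = 0) (h1 : ∀ r, M r r.rev ≠ 0) : M.det ≠ 0 := by
  have hP : (M.submatrix id Fin.revPerm).det ≠ 0 := by
    rw [Matrix.det_of_isUpperTriangular]
    · exact Finset.prod_ne_zero_iff.2 fun r _ => h1 r
    · intro a b hab
      exact h0 _ _ (Fin.rev_lt_rev.2 hab)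
  intro h
  apply hP
  rw [Matrix.det_permute', h, mul_zero]

theorem inv_eq_zero_of_lt {s : Matrix (Fin n) (Fin n) F} (hdet : s.det ≠ 0)
    (h0 : ∀ i q : Fin n, i < q.rev → s i q = 0) (i q : Fin n) (hiq : q.rev < i) :
    s⁻¹ i q = 0 := by
  have hs := (Matrix.isUnit_iff_isUnit_det s).2 (isUnit_iff_ne_zero.2 hdet)
  have hP : (s.submatrix Fin.revPerm id).BlockTriangular (id : Fin n → Fin n) := by
    intro a b hab
    exact h0 _ _ (by simpa using hab)
  have : Invertible (s.submatrix Fin.revPerm id) :=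
    ((Matrix.isUnit_submatrix_equiv Fin.revPerm (Equiv.refl _)).2 hs).invertible
  have h := Matrix.blockTriangular_inv_of_blockTriangular hP
  have e : (s.submatrix Fin.revPerm id)⁻¹ = s⁻¹.submatrix id Fin.revPerm :=
    Matrix.inv_submatrix_equiv s Fin.revPerm (Equiv.refl _)
  rw [e] at h
  simpa using h (i := i) (j := q.rev) hiq

theorem inv_eq_zero_of_gt {t : Matrix (Fin n) (Fin n) F} (hdet : t.det ≠ 0)
    (h0 : ∀ i q : Fin n, q.rev < i → t i q = 0) (i q : Fin n) (hiq : i < q.rev) :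
    t⁻¹ i q = 0 := by
  have hs := (Matrix.isUnit_iff_isUnit_det t).2 (isUnit_iff_ne_zero.2 hdet)
  have hP : (t.submatrix id Fin.revPerm).BlockTriangular (id : Fin n → Fin n) := by
    intro a b hab
    exact h0 _ _ (by simpa using hab)
  have : Invertible (t.submatrix id Fin.revPerm) :=
    ((Matrix.isUnit_submatrix_equiv (Equiv.refl _) Fin.revPerm).2 hs).invertible
  have h := Matrix.blockTriangular_inv_of_blockTriangular hP
  have e : (t.submatrix id Fin.revPerm)⁻¹ = t⁻¹.submatrix Fin.revPerm id :=
    Matrix.inv_submatrix_equiv t (Equiv.refl _) Fin.revPerm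
  rw [e] at h
  simpa using h (i := i.rev) (j := q) (by simpa [Fin.lt_rev_iff] using hiq)

theorem adjugate_eq_det_smul_inv {s : Matrix (Fin n) (Fin n) F} (hdet : s.det ≠ 0) :
    s.adjugate = s.det • s⁻¹ := by
  rw [Matrix.inv_def, Ring.inverse_eq_inv', smul_smul, mul_inv_cancel₀ hdet, one_smul]

theorem adjugate_eq_zero_of_lt {s : Matrix (Fin n) (Fin n) F} (hdet : s.det ≠ 0)
    (h0 : ∀ i q : Fin n, i < q.rev → s i q = 0) (i q : Fin n) (hiq : q.rev < i) :
    s.adjugate i q = 0 := by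
  rw [adjugate_eq_det_smul_inv hdet, Matrix.smul_apply, inv_eq_zero_of_lt hdet h0 i q hiq,
    smul_zero]

theorem adjugate_antidiagonal_mul {s : Matrix (Fin n) (Fin n) F} (hdet : s.det ≠ 0)
    (h0 : ∀ i q : Fin n, i < q.rev → s i q = 0) (p : Fin n) :
    s.adjugate p p.rev * s p.rev p = s.det := by
  have h : (s.adjugate * s) p p = s.det := by
    rw [Matrix.adjugate_mul, Matrix.smul_apply, Matrix.one_apply_eq, smul_eq_mul, mul_one]
  rw [← h, Matrix.mul_apply, Finset.sum_eq_single p.rev]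
  · intro q _ hq
    rcases lt_or_gt_of_ne hq with hlt | hgt
    · rw [h0 q p hlt, mul_zero]
    · rw [adjugate_eq_zero_of_lt hdet h0 p q (by simpa [Fin.rev_lt_iff] using hgt), zero_mul]
  · simp

/-- Every mixed determinant on or below the anti-diagonal is nonzero at some matrix. -/
theorem exists_det_mixedMatrix_ne_zero {i j : Fin n} (hij : j.rev ≤ i) :
    ∃ s : Matrix (Fin n) (Fin n) F, (mixedMatrix s s.adjugate i j).det ≠ 0 := by
  have hv := Fin.val_rev j
  have hij' : (j.rev : ℕ) ≤ i := hij
  have hi := i.isLt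
  have hj := j.isLt
  let s : Matrix (Fin n) (Fin n) F := Matrix.of fun p q =>
    if (p : ℕ) + q = n - 1 ∨ (p : ℕ) + q = i + j then 1 else 0
  have h0 : ∀ p q : Fin n, p < q.rev → s p q = 0 := by
    intro p q hpq
    have h1 := Fin.val_rev q
    have h2 : (p : ℕ) < q.rev := hpq
    exact if_neg (by omega)
  have h1 : ∀ p : Fin n, s p p.rev ≠ 0 := by
    intro p
    have h1 := Fin.val_rev p
    have : s p p.rev = 1 := if_pos (by omega)
    rw [this]
    exact one_ne_zero
  have hdet : s.det ≠ 0 := by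
    have : (s.submatrix Fin.revPerm Fin.revPerm).det ≠ 0 := by
      refine det_ne_zero_of_antiTriangular (fun r c hrc => h0 _ _ ?_) fun r => ?_
      · simpa using hrc
      · simpa using h1 r.rev
    rwa [Matrix.det_submatrix_equiv_self] at this
  refine ⟨s, det_ne_zero_of_antiTriangular (fun r c hrc => ?_) fun r => ?_⟩
  · have h2 := Fin.val_rev r
    have h3 : (r.rev : ℕ) < c := hrc
    simp only [mixedMatrix, Matrix.of_apply]
    split_ifs with h
    · exact if_neg (by simp only [initialColumn, Fin.val_castLE]; omega)
    · apply adjugate_eq_zero_of_lt hdet h0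
      simp only [Fin.lt_def, Fin.val_rev, rowFromRev, initialColumn, Fin.val_castLE]
      omega
  · have h2 := Fin.val_rev r
    simp only [mixedMatrix, Matrix.of_apply]
    split_ifs with h
    · have : s ⟨i + r, h⟩ (initialColumn j r.rev) = 1 :=
        if_pos (by simp only [initialColumn, Fin.val_castLE]; omega)
      rw [this]
      exact one_ne_zero
    · have e : initialColumn j r.rev = (rowFromRev j r).rev := by
        ext
        simp only [Fin.val_rev, rowFromRev, initialColumn, Fin.val_castLE]
        omega
      rw [e]
      exact left_ne_zero_of_mul (adjugate_antidiagonal_mul hdet h0 _ ▸ hdet)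

end AntiTriangular

section Recursion

variable {F : Type*} [Field F] {n : ℕ} (L : Subfield F)

theorem corner_mem {m : ℕ} {M : Matrix (Fin (m + 1)) (Fin (m + 1)) F} (hM : M.det ∈ L)
    (hcof : (M.submatrix Fin.succ Fin.castSucc).det ∈ L)
    (hne : (M.submatrix Fin.succ Fin.castSucc).det ≠ 0)
    (hoth : ∀ c : Fin m, M 0 c.castSucc * (M.submatrix Fin.succ c.castSucc.succAbove).det ∈ L) :
    M 0 (Fin.last m) ∈ L := by
  rw [Matrix.det_succ_row_zero, Fin.sum_univ_castSucc, Fin.succAbove_last] at hM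
  have h1 : ∑ c : Fin m, (-1 : F) ^ ((c.castSucc : Fin (m + 1)) : ℕ) * M 0 c.castSucc *
      (M.submatrix Fin.succ c.castSucc.succAbove).det ∈ L := by
    refine sum_mem fun c _ => ?_
    rw [mul_assoc]
    exact mul_mem (pow_mem (neg_mem (one_mem _)) _) (hoth c)
  have h2 := (add_mem_cancel_left h1).1 hM
  have h3 := div_mem h2 (mul_mem (pow_mem (neg_mem (one_mem L)) (Fin.last m : ℕ)) hcof)
  convert h3 using 1
  field_simp

theorem det_mem {m : ℕ} {M : Matrix (Fin m) (Fin m) F} (h : ∀ i j, M i j ∈ L) : M.det ∈ L := by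
  rw [Matrix.det_apply]
  refine sum_mem fun σ _ => ?_
  rcases Int.units_eq_one_or (Equiv.Perm.sign σ) with e | e <;> rw [e]
  · rw [one_smul]
    exact prod_mem fun i _ => h _ _
  · rw [Units.neg_smul, one_smul]
    exact neg_mem (prod_mem fun i _ => h _ _)

/-- The permutation matrix of the anti-diagonal. -/
def antiDiagonal (R : Type*) [CommRing R] (n : ℕ) : Matrix (Fin n) (Fin n) R :=
  Matrix.of fun p q => if q = p.rev then 1 else 0

theorem mul_antiDiagonal (A : Matrix (Fin n) (Fin n) F) :
    A * antiDiagonal F n = A.submatrix id Fin.rev := by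
  ext p q
  rw [Matrix.mul_apply, Finset.sum_eq_single q.rev]
  · simp [antiDiagonal]
  · intro k _ hk
    have : q ≠ k.rev := fun h => hk (by rw [h, Fin.rev_rev])
    simp [antiDiagonal, this]
  · simp

theorem antiDiagonal_mul_self : antiDiagonal F n * antiDiagonal F n = 1 := by
  rw [mul_antiDiagonal]
  ext p q
  simp [antiDiagonal, Matrix.one_apply, eq_comm]

theorem cofactor_mixedMatrix_last (A : Matrix (Fin n) (Fin n) F) {i j : Fin n}
    (hi : (i : ℕ) + 1 = n) :
    ((mixedMatrix A (antiDiagonal F n) i j).submatrix Fin.succ Fin.castSucc).det ∈ L ∧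
    ((mixedMatrix A (antiDiagonal F n) i j).submatrix Fin.succ Fin.castSucc).det ≠ 0 := by
  have key : ∀ r c : Fin j, (mixedMatrix A (antiDiagonal F n) i j) r.succ c.castSucc =
      if c = r.rev then 1 else 0 := by
    intro r c
    have h : ¬ (i : ℕ) + r.succ < n := by rw [Fin.val_succ]; omega
    simp only [mixedMatrix, Matrix.of_apply, h, dite_false, antiDiagonal]
    congr 1
    simp only [Fin.ext_iff, initialColumn, rowFromRev, Fin.val_rev, Fin.val_castLE,
      Fin.val_castSucc, Fin.val_succ]
    have := j.isLt
    have := r.isLt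
    rw [eq_iff_iff]
    omega
  refine ⟨det_mem L fun r c => ?_, det_ne_zero_of_antiTriangular (fun r c hrc => ?_) fun r => ?_⟩
  · rw [Matrix.submatrix_apply, key]
    split_ifs
    · exact one_mem _
    · exact zero_mem _
  · rw [Matrix.submatrix_apply, key, if_neg hrc.ne']
  · rw [Matrix.submatrix_apply, key, if_pos rfl]
    exact one_ne_zero

/-- If all determinants of a family of mixed matrices lie in a subfield and do not vanish, then so
do the cofactors of their top right corners. -/
theorem cofactor_mixedMatrix_mem (A : Matrix (Fin n) (Fin n) F) {i j : Fin n}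
    (hij : j.rev ≤ i)
    (h : ∀ i' j' : Fin n, (i' : ℕ) = i + 1 → (j' : ℕ) + 1 = j →
      (mixedMatrix A (antiDiagonal F n) i' j').det ∈ L ∧
      (mixedMatrix A (antiDiagonal F n) i' j').det ≠ 0) :
    ((mixedMatrix A (antiDiagonal F n) i j).submatrix Fin.succ Fin.castSucc).det ∈ L ∧
    ((mixedMatrix A (antiDiagonal F n) i j).submatrix Fin.succ Fin.castSucc).det ≠ 0 := by
  have hij' : (j.rev : ℕ) ≤ i := hij
  have hv := Fin.val_rev j
  obtain ⟨i, hi⟩ := i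
  obtain ⟨j, hj⟩ := j
  simp only at hij' hv h
  rcases eq_or_ne (i + 1) n with hn | hn
  · exact cofactor_mixedMatrix_last L A hn
  · obtain ⟨j, rfl⟩ : ∃ k, j = k + 1 := ⟨j - 1, by omega⟩
    have e := cofactor_mixedMatrix_succ A (antiDiagonal F n) (i := i) (j := j) (by omega) hj
    erw [e]
    exact h _ _ rfl rfl

variable {L}

variable {s : Matrix (Fin n) (Fin n) F} (h0 : ∀ i q : Fin n, i < q.rev → s i q = 0)
  (hL : ∀ i j : Fin n, j.rev ≤ i → (mixedMatrix s s.adjugate i j).det ∈ L)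
  (hne : ∀ i j : Fin n, j.rev ≤ i → (mixedMatrix s s.adjugate i j).det ≠ 0)

include h0 hL hne

theorem antidiagonal_mem (p : Fin n) : s p p.rev ∈ L := by
  have e : ∀ j : Fin n, mixedMatrix s (antiDiagonal F n) j.rev j =
    mixedMatrix s s.adjugate j.rev j := fun j => mixedMatrix_eq_of_rev_eq _ _ _ rfl
  have hc := cofactor_mixedMatrix_mem L s (i := p) (j := p.rev) (by simp) ?_
  · have := corner_mem L (M := mixedMatrix s (antiDiagonal F n) p p.rev) ?_ hc.1 hc.2 ?_
    · rwa [mixedMatrix_zero_last] at this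
    · have := e p.rev
      rw [Fin.rev_rev] at this
      rw [this]
      exact hL _ _ (by simp)
    · intro c
      have : mixedMatrix s (antiDiagonal F n) p p.rev 0 c.castSucc = 0 := by
        have hp : (p : ℕ) + (0 : Fin (p.rev + 1)) < n := by simp
        simp only [mixedMatrix, Matrix.of_apply, hp, dite_true]
        apply h0
        have := c.isLt
        have := Fin.val_rev p
        simp only [Fin.lt_def, Fin.val_rev, initialColumn, Fin.val_castLE, Fin.val_castSucc,
          Fin.val_zero]
        omega
      rw [this, zero_mul]
      exact zero_mem _
  · intro i' j' h1 h2
    have h3 := Fin.val_rev p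
    have h4 : i' = j'.rev := by
      ext
      rw [Fin.val_rev]
      omega
    rw [h4, e]
    exact ⟨hL _ _ le_rfl, hne _ _ le_rfl⟩

theorem det_mem_of_mixedMatrix : s.det ∈ L := by
  rcases n with _ | m
  · simp
  · have h := hL 0 (Fin.last m) (by simp)
    have e : (mixedMatrix s s.adjugate 0 (Fin.last m)).det = s.det := by
      show Matrix.det (n := Fin (m + 1)) _ = _
      congr 1
      ext r t
      have : ((0 : Fin (m + 1)) : ℕ) + r < m + 1 := by
        rw [Fin.val_zero, zero_add]
        exact r.isLt
      simp only [mixedMatrix, Matrix.of_apply, this, dite_true]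
      congr 1
      ext
      simp
    rwa [e] at h

theorem adjugate_antidiagonal_mem (hdet : s.det ≠ 0) (p : Fin n) :
    s.adjugate p p.rev ∈ L ∧ s.adjugate p p.rev ≠ 0 := by
  have h := adjugate_antidiagonal_mul hdet h0 p
  have h1 : s p.rev p ∈ L := by simpa using antidiagonal_mem h0 hL hne p.rev
  have h2 : s p.rev p ≠ 0 := right_ne_zero_of_mul (h ▸ hdet)
  refine ⟨?_, left_ne_zero_of_mul (h ▸ hdet)⟩
  rw [eq_div_of_mul_eq h2 h]
  exact div_mem (det_mem_of_mixedMatrix h0 hL hne) h1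

theorem det_mixedMatrix_antiDiagonal_mem (hdet : s.det ≠ 0) {i j : Fin n} (hij : j.rev ≤ i) :
    (mixedMatrix s (antiDiagonal F n) i j).det ∈ L ∧
    (mixedMatrix s (antiDiagonal F n) i j).det ≠ 0 := by
  have h1 : (1 : Matrix (Fin n) (Fin n) F).BlockTriangular (id : Fin n → Fin n) :=
    Matrix.blockTriangular_one
  have h2 : (s.adjugate * antiDiagonal F n).BlockTriangular (id : Fin n → Fin n) := by
    intro p q hpq
    rw [mul_antiDiagonal, Matrix.submatrix_apply]
    exact adjugate_eq_zero_of_lt hdet h0 _ _ (by simpa using hpq)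
  have h3 : IsBlockUnipotent (id : Fin n → Fin n) (1 : Matrix (Fin n) (Fin n) F) :=
    fun _ _ _ => rfl
  have h := det_mixedMatrix_mul (A := s) (B := antiDiagonal F n) h1 h2 h3 hij
  rw [one_mul, mul_one, mul_one, Matrix.mul_assoc, antiDiagonal_mul_self, mul_one] at h
  set P := ∏ r : Fin (j + 1), if hr : (i : ℕ) + r < n then
    (1 : Matrix (Fin n) (Fin n) F) ⟨i + r, hr⟩ ⟨i + r, hr⟩
    else (s.adjugate * antiDiagonal F n) (rowFromRev j r) (rowFromRev j r) with hP
  have hPL : P ∈ L := by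
    refine prod_mem fun r _ => ?_
    split_ifs
    · rw [Matrix.one_apply_eq]
      exact one_mem _
    · rw [mul_antiDiagonal, Matrix.submatrix_apply]
      exact (adjugate_antidiagonal_mem h0 hL hne hdet _).1
  have hne' := hne i j hij
  rw [h] at hne'
  have hP0 : P ≠ 0 := left_ne_zero_of_mul hne'
  refine ⟨?_, right_ne_zero_of_mul hne'⟩
  rw [← mul_div_cancel_left₀ (mixedMatrix s (antiDiagonal F n) i j).det hP0, ← h]
  exact div_mem (hL i j hij) hPL

/-- A matrix that vanishes above the anti-diagonal has its entries in any field that contains its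
mixed determinants, if these do not vanish. -/
theorem mem_of_det_mixedMatrix_mem (hdet : s.det ≠ 0) (i j : Fin n) : s i j ∈ L := by
  have hW := fun {i j : Fin n} (hij : j.rev ≤ i) =>
    det_mixedMatrix_antiDiagonal_mem h0 hL hne hdet hij
  induction hk : (i.rev : ℕ) using Nat.strong_induction_on generalizing i j with
  | _ k ih =>
    subst hk
    induction hl : (j : ℕ) using Nat.strong_induction_on generalizing j with
    | _ l ihl =>
      subst hl
      rcases lt_or_ge i j.rev with hij | hij
      · rw [h0 i j hij]
        exact zero_mem _
      have hij' : (j.rev : ℕ) ≤ i := hij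
      have hv := Fin.val_rev j
      have hi := Fin.val_rev i
      have hc := cofactor_mixedMatrix_mem L s hij fun i' j' h1 h2 => hW (by
        rw [Fin.le_def, Fin.val_rev]
        omega)
      have hrow : ∀ r c : Fin (j + 1), (r ≠ 0 ∨ (c : ℕ) < j) →
          mixedMatrix s (antiDiagonal F n) i j r c ∈ L := by
        intro r c hrc
        simp only [mixedMatrix, Matrix.of_apply]
        split_ifs with h
        · by_cases hr : r = 0
          · subst hr
            have := ihl c (hrc.resolve_left fun h => h rfl) (initialColumn j c) rfl
            simpa using this
          · have hr' : (r : ℕ) ≠ 0 := fun h => hr (Fin.ext (by simpa using h))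
            have hi' := i.isLt
            refine ih _ ?_ _ _ rfl
            simp only [Fin.val_rev]
            omega
        · simp only [antiDiagonal, Matrix.of_apply]
          split_ifs
          · exact one_mem _
          · exact zero_mem _
      have := corner_mem L (hW hij).1 hc.1 hc.2 fun c => mul_mem (hrow _ _ (Or.inr (by simp)))
        (det_mem L fun a b => hrow _ _ (Or.inl (Fin.succ_ne_zero _)))
      rwa [mixedMatrix_zero_last] at this

end Recursion

section NormalForm

variable {F : Type*} [Field F] {n : ℕ}

theorem exists_det_upperMatrix_eq_mul (A : Matrix (Fin n) (Fin n) F) :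
    ∃ C : Matrix (Fin n) (Fin n) F, (∀ k q : Fin n, q.rev < k → C k q = 0) ∧
      A * C = Matrix.of fun i q => (upperMatrix A i q.rev).det := by
  let d : ∀ q : Fin n, Fin (q.rev + 1) → F := fun q t =>
    (-1) ^ (t : ℕ) * ((upperMatrix A q q.rev).submatrix Fin.succ t.succAbove).det
  refine ⟨Matrix.of fun k q => Function.extend (initialColumn q.rev) (d q) 0 k, ?_, ?_⟩
  · intro k q hkq
    rw [Matrix.of_apply, Function.extend_apply']
    · rfl
    · rintro ⟨t, rfl⟩
      have ht := t.isLt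
      have : (q.rev : ℕ) < t := hkq
      omega
  · ext i q
    have e : ∀ t : Fin (q.rev + 1), (upperMatrix A i q.rev).submatrix Fin.succ t.succAbove =
        (upperMatrix A q q.rev).submatrix Fin.succ t.succAbove := by
      intro t
      ext r c
      simp [upperMatrix, Fin.succ_ne_zero]
    rw [Matrix.mul_apply, Matrix.of_apply, Matrix.det_succ_row_zero]
    symm
    refine Fintype.sum_of_injective _ (initialColumn_injective q.rev) _ _ (fun k hk => ?_)
      fun t => ?_
    · rw [Matrix.of_apply, Function.extend_apply' _ _ _ hk, Pi.zero_apply, mul_zero]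
    · rw [Matrix.of_apply, (initialColumn_injective q.rev).extend_apply, e]
      have : upperMatrix A i q.rev 0 t = A i (initialColumn q.rev t) := rfl
      rw [this]
      ring

variable {L : Subfield F}

theorem adjugate_mem {m : ℕ} {M : Matrix (Fin m) (Fin m) F} (h : ∀ i j, M i j ∈ L) (i j : Fin m) :
    M.adjugate i j ∈ L := by
  rw [Matrix.adjugate_apply]
  refine det_mem L fun a b => ?_
  rw [Matrix.updateRow_apply]
  split_ifs
  · rw [Pi.single_apply]
    split_ifs
    · exact one_mem _
    · exact zero_mem _
  · exact h _ _

theorem mul_mem_of_mem {m : ℕ} {M N : Matrix (Fin m) (Fin m) F} (hM : ∀ i j, M i j ∈ L)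
    (hN : ∀ i j, N i j ∈ L) (i j : Fin m) : (M * N) i j ∈ L := by
  rw [Matrix.mul_apply]
  exact sum_mem fun k _ => mul_mem (hM _ _) (hN _ _)

/-- The matrix that conjugates `A` to a matrix that vanishes above the anti-diagonal. -/
def antiConjugator (A : Matrix (Fin n) (Fin n) F) : Matrix (Fin n) (Fin n) F :=
  Matrix.of fun i q => (upperMatrix A i q.rev).det / (upperMatrix A q q.rev).det

theorem upperMatrix_rev_ne_zero {A : Matrix (Fin n) (Fin n) F}
    (hne : ∀ i j : Fin n, j.rev ≤ i → (mixedMatrix A A.adjugate i j).det ≠ 0) (q : Fin n) :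
    (upperMatrix A q q.rev).det ≠ 0 := by
  rw [upperMatrix_rev A A.adjugate]
  exact hne _ _ (by simp)

theorem isBlockUnipotent_antiConjugator {A : Matrix (Fin n) (Fin n) F}
    (hne : ∀ i j : Fin n, j.rev ≤ i → (mixedMatrix A A.adjugate i j).det ≠ 0) :
    IsBlockUnipotent (id : Fin n → Fin n) (antiConjugator A) := by
  intro i q hiq
  rcases eq_or_lt_of_le (show q ≤ i from hiq) with rfl | hlt
  · rw [Matrix.one_apply_eq]
    exact div_self (upperMatrix_rev_ne_zero hne _)
  · rw [Matrix.one_apply_ne hlt.ne', antiConjugator, Matrix.of_apply,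
      det_upperMatrix_eq_zero A (by simpa using hlt), zero_div]

theorem conj_antiConjugator_eq_zero {A : Matrix (Fin n) (Fin n) F} (hdet : A.det ≠ 0)
    (hne : ∀ i j : Fin n, j.rev ≤ i → (mixedMatrix A A.adjugate i j).det ≠ 0) (i q : Fin n)
    (hiq : i < q.rev) : ((antiConjugator A)⁻¹ * A * antiConjugator A) i q = 0 := by
  have hG := isBlockUnipotent_antiConjugator hne
  have hGi := hG.inv monotone_id
  obtain ⟨C, hC0, hC⟩ := exists_det_upperMatrix_eq_mul A
  let u : Fin n → F := fun q => (upperMatrix A q q.rev).det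
  have h1 : antiConjugator A = A * (C * Matrix.diagonal fun q => (u q)⁻¹) := by
    rw [← Matrix.mul_assoc, hC]
    ext i q
    rw [Matrix.mul_diagonal]
    exact div_eq_mul_inv _ _
  have hA : IsUnit A.det := isUnit_iff_ne_zero.2 hdet
  have h2 : ((antiConjugator A)⁻¹ * A⁻¹ * antiConjugator A)⁻¹ =
      (antiConjugator A)⁻¹ * A * antiConjugator A := by
    rw [Matrix.mul_inv_rev, Matrix.mul_inv_rev, Matrix.nonsing_inv_nonsing_inv _ hA,
      Matrix.nonsing_inv_nonsing_inv _ (by rw [hG.det_eq_one monotone_id]; exact isUnit_one),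
      Matrix.mul_assoc]
  rw [← h2]
  refine inv_eq_zero_of_gt ?_ (fun i q hiq => ?_) i q hiq
  · rw [hG.det_conj monotone_id, Matrix.det_nonsing_inv]
    exact (isUnit_ringInverse.2 hA).ne_zero
  · have h3 : A⁻¹ * antiConjugator A = C * Matrix.diagonal fun q => (u q)⁻¹ := by
      conv_lhs => rw [h1]
      exact Matrix.nonsing_inv_mul_cancel_left _ _ hA
    rw [Matrix.mul_assoc, h3, Matrix.mul_apply]
    refine Finset.sum_eq_zero fun k _ => ?_
    rw [Matrix.mul_diagonal]
    rcases lt_or_ge k i with hk | hk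
    · rw [hGi.blockTriangular (show id k < id i from hk), zero_mul]
    · rw [hC0 k q (hiq.trans_le hk), zero_mul, mul_zero]

/-- A matrix is conjugate by a block unipotent matrix to a matrix with entries in any field that
contains its mixed determinants and the minors attached to the pairs of indices in one block, if
the mixed determinants do not vanish. -/
theorem exists_conj_mem {ι : Type*} [LinearOrder ι] {b : Fin n → ι} (hb : Monotone b)
    {A : Matrix (Fin n) (Fin n) F} (hdet : A.det ≠ 0)
    (hne : ∀ i j : Fin n, j.rev ≤ i → (mixedMatrix A A.adjugate i j).det ≠ 0)
    (hL : ∀ i j : Fin n, j.rev ≤ i → (mixedMatrix A A.adjugate i j).det ∈ L)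
    (hU : ∀ i q : Fin n, i ≤ q → b i = b q → (upperMatrix A i q.rev).det ∈ L) :
    ∃ G : Matrix (Fin n) (Fin n) F, IsBlockUnipotent b G ∧ ∀ i j, (G⁻¹ * A * G) i j ∈ L := by
  have hG := isBlockUnipotent_antiConjugator hne
  set G₀ := antiConjugator A with hG₀
  have hS : ∀ i j, (G₀⁻¹ * A * G₀) i j ∈ L := by
    refine mem_of_det_mixedMatrix_mem (conj_antiConjugator_eq_zero hdet hne)
      (fun i j hij => ?_) (fun i j hij => ?_) ?_
    · rw [det_mixedMatrix_conj hG A hij]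
      exact hL i j hij
    · rw [det_mixedMatrix_conj hG A hij]
      exact hne i j hij
    · rwa [hG.det_conj monotone_id]
  let M : Matrix (Fin n) (Fin n) F := Matrix.of fun i q => if b i = b q then G₀ i q else 0
  have hM : IsBlockUnipotent (id : Fin n → Fin n) M := by
    intro i q hiq
    simp only [M, Matrix.of_apply]
    split_ifs with h
    · exact hG i q hiq
    · rw [Matrix.one_apply_ne]
      rintro rfl
      exact h rfl
  have hML : ∀ i q, M i q ∈ L := by
    intro i q
    rcases lt_or_ge q i with h | h
    · rw [hM i q h.le, Matrix.one_apply_ne h.ne']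
      exact zero_mem _
    · simp only [M, Matrix.of_apply]
      split_ifs with h'
      · refine div_mem (hU i q h h') ?_
        rw [upperMatrix_rev A A.adjugate]
        exact hL _ _ (by simp)
      · exact zero_mem _
  have hMi := hM.inv monotone_id
  refine ⟨G₀ * M⁻¹, fun i j hij => ?_, ?_⟩
  · have h1 : G₀ * M⁻¹ = 1 + (G₀ - M) * M⁻¹ := by
      rw [sub_mul, hM.mul_inv monotone_id]
      abel
    rw [h1, Matrix.add_apply, add_eq_left, Matrix.mul_apply]
    refine Finset.sum_eq_zero fun k _ => ?_
    rcases lt_or_ge j k with hk | hk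
    · rw [hMi.blockTriangular (show id j < id k from hk), mul_zero]
    · have h2 : b k ≤ b i := (hb hk).trans hij
      have h3 : (G₀ - M) i k = 0 := by
        simp only [M, Matrix.sub_apply, Matrix.of_apply]
        split_ifs with h
        · exact sub_self _
        · have hlt : k < i := lt_of_not_ge fun h' => h (le_antisymm (hb h') h2)
          rw [hG i k hlt.le, Matrix.one_apply_ne hlt.ne', sub_zero]
      rw [h3, zero_mul]
  · have h1 : (G₀ * M⁻¹)⁻¹ * A * (G₀ * M⁻¹) = M * (G₀⁻¹ * A * G₀) * M.adjugate := by
      rw [Matrix.mul_inv_rev, Matrix.nonsing_inv_nonsing_inv _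
        (by rw [hM.det_eq_one monotone_id]; exact isUnit_one), hM.adjugate_eq monotone_id]
      simp only [Matrix.mul_assoc]
    rw [h1]
    exact mul_mem_of_mem (mul_mem_of_mem hML hS) (adjugate_mem hML)

end NormalForm

section Density

variable {K F : Type*} [Field K] [Field F] [Algebra K F] {σ : Type*}

theorem eq_zero_of_eval_algebraMap [Infinite K] {P : MvPolynomial σ F}
    (h : ∀ t : σ → K, eval (fun i => algebraMap K F (t i)) P = 0) : P = 0 := by
  refine funext_set (fun _ => Set.range (algebraMap K F))
    (fun _ => Set.infinite_range_of_injective (algebraMap K F).injective) fun x hx => ?_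
  have hx' : ∀ i, ∃ a : K, algebraMap K F a = x i := fun i => hx i (Set.mem_univ i)
  choose t ht using hx'
  have : (fun i => algebraMap K F (t i)) = x := funext ht
  rw [map_zero, ← this, h]

theorem aeval_mem_of_mem {L : IntermediateField K F} {f : σ → F} (hf : ∀ i, f i ∈ L)
    (p : MvPolynomial σ K) : aeval f p ∈ L := by
  have := comp_aeval_apply (f := fun i => (⟨f i, hf i⟩ : L)) L.val p
  have h2 : (aeval fun i => L.val (⟨f i, hf i⟩ : L)) p = aeval f p := rfl
  rw [← h2, ← this]
  exact Subtype.property _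

end Density

section Parametrization

variable {n : ℕ} {ι : Type*} [LinearOrder ι] (b : Fin n → ι)

/-- The block unipotent matrix with the given entries above the block diagonal. -/
def blockUnipotent {R : Type*} [CommRing R] (t : Fin n × Fin n → R) :
    Matrix (Fin n) (Fin n) R :=
  Matrix.of fun i j => if b j ≤ b i then (1 : Matrix (Fin n) (Fin n) R) i j else t (i, j)

theorem isBlockUnipotent_blockUnipotent {R : Type*} [CommRing R] (t : Fin n × Fin n → R) :
    IsBlockUnipotent b (blockUnipotent b t) :=
  fun _ _ hij => if_pos hij

variable {b} in
theorem IsBlockUnipotent.blockUnipotent_eq {R : Type*} [CommRing R] {g : Matrix (Fin n) (Fin n) R}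
    (hg : IsBlockUnipotent b g) : blockUnipotent b (fun p => g p.1 p.2) = g := by
  ext i j
  by_cases h : b j ≤ b i
  · rw [hg i j h]
    exact if_pos h
  · exact if_neg h

theorem blockUnipotent_map {R S : Type*} [CommRing R] [CommRing S] (f : R →+* S)
    (t : Fin n × Fin n → R) :
    (blockUnipotent b t).map f = blockUnipotent b (fun p => f (t p)) := by
  ext i j
  simp only [blockUnipotent, Matrix.map_apply, Matrix.of_apply, Matrix.one_apply]
  split_ifs <;> simp

variable {b} in
theorem IsBlockUnipotent.map {R S : Type*} [CommRing R] [CommRing S] (f : R →+* S)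
    {g : Matrix (Fin n) (Fin n) R} (hg : IsBlockUnipotent b g) : IsBlockUnipotent b (g.map f) := by
  intro i j hij
  rw [Matrix.map_apply, hg i j hij, Matrix.one_apply, Matrix.one_apply]
  split_ifs <;> simp

theorem adjugate_map {R S : Type*} [CommRing R] [CommRing S] (f : R →+* S)
    (A : Matrix (Fin n) (Fin n) R) : A.adjugate.map f = (A.map f).adjugate :=
  RingHom.map_adjugate f A

variable {K F : Type*} [Field K] [Field F] [Algebra K F]

/-- The matrix `Y A Y⁻¹` for a variable block unipotent matrix `Y`. -/
noncomputable def variableConj (A : Matrix (Fin n) (Fin n) F) :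
    Matrix (Fin n) (Fin n) (MvPolynomial (Fin n × Fin n) F) :=
  blockUnipotent b X * A.map (C (σ := Fin n × Fin n)) * (blockUnipotent b X).adjugate

theorem variableConj_map_eval (A : Matrix (Fin n) (Fin n) F) (t : Fin n × Fin n → F) :
    (variableConj b A).map (eval t) =
      blockUnipotent b t * A * (blockUnipotent b t).adjugate := by
  have h1 : (A.map (C (σ := Fin n × Fin n))).map (eval t) = A := by
    ext
    simp
  rw [variableConj, Matrix.map_mul, Matrix.map_mul, adjugate_map, h1, blockUnipotent_map]
  simp

/-- The function `p (Y A Y⁻¹)` of a variable block unipotent matrix `Y`. -/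
noncomputable def orbitPolynomial (A : Matrix (Fin n) (Fin n) F)
    (p : MvPolynomial (Fin n × Fin n) K) : MvPolynomial (Fin n × Fin n) F :=
  aeval (fun x => variableConj b A x.1 x.2) p

theorem eval_orbitPolynomial (A : Matrix (Fin n) (Fin n) F) (p : MvPolynomial (Fin n × Fin n) K)
    (t : Fin n × Fin n → F) : eval t (orbitPolynomial b A p) =
      aeval (fun x => (blockUnipotent b t * A * (blockUnipotent b t).adjugate) x.1 x.2) p := by
  let φ : MvPolynomial (Fin n × Fin n) F →ₐ[K] F :=
    (aeval t : MvPolynomial (Fin n × Fin n) F →ₐ[F] F).restrictScalars K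
  have hφ : ∀ q, φ q = eval t q := fun q => by
    rw [← coe_aeval_eq_eval]
    rfl
  rw [← hφ, orbitPolynomial, comp_aeval_apply, ← variableConj_map_eval]
  simp only [hφ, Matrix.map_apply]

variable {b}

/-- If a matrix `X` is conjugate by a block unipotent matrix to a matrix with entries in `L`, then
`L` contains every quotient of polynomials in `X` that is invariant under the conjugation by block
unipotent matrices over the ground field. -/
theorem mem_of_conj_invariant [Infinite K] (hb : Monotone b) {L : IntermediateField K F}
    {A G : Matrix (Fin n) (Fin n) F} (hG : IsBlockUnipotent b G)
    (hS : ∀ i j, (G⁻¹ * A * G) i j ∈ L) {p q : MvPolynomial (Fin n × Fin n) K} {f : F}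
    (hq : aeval (fun x => A x.1 x.2) q ≠ 0)
    (hinv : ∀ Z : Matrix (Fin n) (Fin n) K, IsBlockUnipotent b Z →
      aeval (fun x => (Z.map (algebraMap K F) * A * (Z.map (algebraMap K F)).adjugate) x.1 x.2) p =
      f * aeval (fun x => (Z.map (algebraMap K F) * A *
        (Z.map (algebraMap K F)).adjugate) x.1 x.2) q) : f ∈ L := by
  have h1 : orbitPolynomial b A p - C f * orbitPolynomial b A q = 0 := by
    refine eq_zero_of_eval_algebraMap (K := K) fun t => ?_
    have := hinv _ (isBlockUnipotent_blockUnipotent b t)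
    rw [blockUnipotent_map] at this
    rw [map_sub, map_mul, eval_C, eval_orbitPolynomial, eval_orbitPolynomial, this, sub_self]
  have h2 : ∀ Z : Matrix (Fin n) (Fin n) F, IsBlockUnipotent b Z →
      aeval (fun x => (Z * A * Z.adjugate) x.1 x.2) p =
      f * aeval (fun x => (Z * A * Z.adjugate) x.1 x.2) q := by
    intro Z hZ
    have := congrArg (eval fun x => Z x.1 x.2) h1
    rw [map_sub, map_mul, eval_C, eval_orbitPolynomial, eval_orbitPolynomial, map_zero,
      hZ.blockUnipotent_eq, sub_eq_zero] at this
    exact this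
  have h3 : orbitPolynomial b (G⁻¹ * A * G) q ≠ 0 := by
    intro h
    have := congrArg (eval fun x => G x.1 x.2) h
    rw [eval_orbitPolynomial, hG.blockUnipotent_eq, map_zero, hG.adjugate_eq hb] at this
    have e : G * (G⁻¹ * A * G) * G⁻¹ = A := by
      rw [Matrix.mul_assoc, Matrix.mul_assoc, Matrix.mul_assoc, hG.mul_inv hb, mul_one,
        ← Matrix.mul_assoc, hG.mul_inv hb, one_mul]
    rw [e] at this
    exact hq this
  obtain ⟨t, ht⟩ : ∃ t : Fin n × Fin n → K, eval (fun i => algebraMap K F (t i))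
      (orbitPolynomial b (G⁻¹ * A * G) q) ≠ 0 := by
    by_contra! h
    exact h3 (eq_zero_of_eval_algebraMap h)
  set W := blockUnipotent b fun i => algebraMap K F (t i) with hWdef
  have hW : IsBlockUnipotent b W := isBlockUnipotent_blockUnipotent b _
  have hWL : ∀ i j, W i j ∈ L.toSubfield := by
    intro i j
    rw [hWdef, ← blockUnipotent_map]
    exact L.algebraMap_mem _
  have h4 := h2 _ (hW.mul (hG.inv hb))
  have e : W * G⁻¹ * A * (W * G⁻¹).adjugate = W * (G⁻¹ * A * G) * W.adjugate := by
    rw [Matrix.adjugate_mul_distrib, (hG.inv hb).adjugate_eq hb,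
      Matrix.nonsing_inv_nonsing_inv _ (by rw [hG.det_eq_one hb]; exact isUnit_one)]
    simp only [Matrix.mul_assoc]
  rw [e] at h4
  rw [eval_orbitPolynomial] at ht
  have h5 : ∀ i j, (W * (G⁻¹ * A * G) * W.adjugate) i j ∈ L :=
    mul_mem_of_mem (L := L.toSubfield) (mul_mem_of_mem hWL hS) (adjugate_mem hWL)
  rw [eq_div_of_mul_eq ht h4.symm]
  exact div_mem (aeval_mem_of_mem (fun x => h5 _ _) p) (aeval_mem_of_mem (fun x => h5 _ _) q)

end Parametrization

section AlgebraicIndependence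

variable {K : Type*} [Field K] {n : ℕ}

theorem algebraicIndependent_of_adjoin_eq_top (y : Fin n × Fin n → RationalFunctions n K)
    (hy : IntermediateField.adjoin K (Set.range y) = ⊤) : AlgebraicIndependent K y := by
  have halg : Algebra.IsAlgebraic (Algebra.adjoin K (Set.range y)) (RationalFunctions n K) := by
    refine ⟨fun f => ?_⟩
    have hf : f ∈ IntermediateField.adjoin K (Set.range y) := hy ▸ IntermediateField.mem_top
    obtain ⟨r, s, rfl⟩ := (IntermediateField.mem_adjoin_range_iff K y f).1 hf
    have hmem : ∀ r : MvPolynomial (Fin n × Fin n) K,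
        IsAlgebraic (Algebra.adjoin K (Set.range y)) (aeval y r) := by
      intro r
      have : aeval y r ∈ Algebra.adjoin K (Set.range y) := by
        rw [Algebra.adjoin_range_eq_range_aeval]
        exact ⟨r, rfl⟩
      exact isAlgebraic_algebraMap (⟨_, this⟩ : Algebra.adjoin K (Set.range y))
    rw [div_eq_mul_inv]
    exact (hmem r).mul (hmem s).inv
  have hX : AlgebraicIndependent K fun p : Fin n × Fin n =>
      algebraMap (MvPolynomial (Fin n × Fin n) K) (RationalFunctions n K) (X p) :=
    (algebraicIndependent_X (Fin n × Fin n) K).map'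
      (f := IsScalarTower.toAlgHom K _ (RationalFunctions n K))
      (IsFractionRing.injective _ _)
  exact (Algebra.IsAlgebraic.isTranscendenceBasis_of_lift_le_trdeg_of_finite K y hX.lift_cardinalMk_le_trdeg).1

end AlgebraicIndependence

theorem index_monotone {n : ℕ} (c : Composition n) : Monotone c.index := by
  intro i j hij
  by_contra! h
  have h1 := c.lt_sizeUpTo_index_succ j
  have h2 := c.sizeUpTo_index_le i
  have h3 : c.sizeUpTo (c.index j).succ ≤ c.sizeUpTo (c.index i) := by
    apply c.monotone_sizeUpTo
    simpa using h
  have h4 : (i : ℕ) ≤ j := hij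
  omega

section

variable {K : Type*} [Field K] {n : ℕ}

theorem J_eq_mixed {i j : Fin n} (hij : j.rev ≤ i) :
    J K i j = (mixedMatrix (genericMatrix n K) (genericMatrix n K).adjugate i j).det := by
  unfold J
  split_ifs with h
  · have e : j = i.rev := by rw [le_antisymm h hij, Fin.rev_rev]
    subst e
    rw [← upperMatrix_rev]
    rfl
  · rfl

theorem J_eq_upper {i j : Fin n} (hij : i ≤ j.rev) :
    J K i j = (upperMatrix (genericMatrix n K) i j).det :=
  if_pos hij

theorem J_ne_zero {i j : Fin n} (hij : j.rev ≤ i) : J K i j ≠ 0 := by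
  obtain ⟨s, hs⟩ := exists_det_mixedMatrix_ne_zero (F := K) hij
  intro h
  apply hs
  rw [J_eq_mixed hij] at h
  have := congrArg (eval fun p : Fin n × Fin n => s p.1 p.2) h
  rw [mixedMatrix_map, map_zero] at this
  have e : (genericMatrix n K).map (eval fun p : Fin n × Fin n => s p.1 p.2) = s := by
    ext
    simp [Matrix.mvPolynomialX_apply]
  rwa [e] at this

theorem conjGeneric_eq (c : Composition n) {g : Matrix.GeneralLinearGroup (Fin n) K}
    (hg : g ∈ unipotentRadical c K) :
    ∃ h : Matrix (Fin n) (Fin n) (MvPolynomial (Fin n × Fin n) K),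
      IsBlockUnipotent c.index h ∧ conjGeneric g = h⁻¹ * genericMatrix n K * h := by
  have hg' : IsBlockUnipotent c.index (g : Matrix (Fin n) (Fin n) K) := hg
  refine ⟨(g : Matrix (Fin n) (Fin n) K).map (C (σ := Fin n × Fin n)), hg'.map C, ?_⟩
  rw [conjGeneric, ← (hg'.map C).adjugate_eq (index_monotone c), ← adjugate_map,
    hg'.adjugate_eq (index_monotone c), Matrix.coe_units_inv]

theorem conjHom_J (c : Composition n) {g : Matrix.GeneralLinearGroup (Fin n) K}
    (hg : g ∈ unipotentRadical c K) {i j : Fin n} (hij : (i, j) ∈ indexSet c) :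
    conjHom g (J K i j) = J K i j := by
  have hb := index_monotone c
  obtain ⟨h, hh, e⟩ := conjGeneric_eq c hg
  have e1 : (genericMatrix n K).map (conjHom g).toRingHom =
      h⁻¹ * genericMatrix n K * h := by
    rw [← e, ← map_conjHom_genericMatrix]
    rfl
  rcases le_total i j.rev with hle | hle
  · rw [J_eq_upper hle]
    have := upperMatrix_map (conjHom g).toRingHom
      (genericMatrix n K) i j
    rw [e1, det_upperMatrix_conj hb hh _ hle hij] at this
    exact this
  · rw [J_eq_mixed hle]
    have := mixedMatrix_map (conjHom g).toRingHom
      (genericMatrix n K) i j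
    rw [e1, det_mixedMatrix_conj (hh.to_id hb) _ hle] at this
    exact this

theorem mem_invariantField_iff (c : Composition n) (f : RationalFunctions n K) :
    f ∈ invariantField c K ↔ ∀ g ∈ unipotentRadical c K, conjRational n K g f = f := by
  rw [invariantField, IntermediateField.mem_fixedField_iff]
  exact ⟨fun h g hg => h _ (Subgroup.mem_map_of_mem _ hg), by rintro h _ ⟨g, hg, rfl⟩; exact h g hg⟩

theorem conjRational_algebraMap (g : Matrix.GeneralLinearGroup (Fin n) K)
    (p : MvPolynomial (Fin n × Fin n) K) :
    conjRational n K g (algebraMap _ (RationalFunctions n K) p) =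
      algebraMap _ (RationalFunctions n K) (conjHom g p) :=
  IsFractionRing.fieldEquivOfAlgEquiv_algebraMap K (RationalFunctions n K)
    (RationalFunctions n K) (conjPoly n K g) p

/-- The generic matrix over the field of rational functions. -/
noncomputable def genericMatrixRational (n : ℕ) (K : Type*) [Field K] :
    Matrix (Fin n) (Fin n) (RationalFunctions n K) :=
  (genericMatrix n K).map (algebraMap _ (RationalFunctions n K))

theorem aeval_genericMatrixRational (p : MvPolynomial (Fin n × Fin n) K) :
    aeval (fun x => genericMatrixRational n K x.1 x.2) p =
      algebraMap _ (RationalFunctions n K) p := by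
  have := comp_aeval_apply (X : Fin n × Fin n → MvPolynomial (Fin n × Fin n) K)
    (IsScalarTower.toAlgHom K _ (RationalFunctions n K)) p
  rw [aeval_X_left_apply] at this
  rw [IsScalarTower.coe_toAlgHom'] at this
  rw [this]
  simp only [genericMatrixRational, Matrix.map_apply, Matrix.mvPolynomialX_apply]

theorem algebraMap_conjHom (g : Matrix.GeneralLinearGroup (Fin n) K)
    (p : MvPolynomial (Fin n × Fin n) K) :
    algebraMap _ (RationalFunctions n K) (conjHom g p) =
      aeval (fun x => (((g⁻¹ : Matrix.GeneralLinearGroup (Fin n) K) :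
        Matrix (Fin n) (Fin n) K).map (algebraMap K (RationalFunctions n K)) *
        genericMatrixRational n K * (g : Matrix (Fin n) (Fin n) K).map
          (algebraMap K (RationalFunctions n K))) x.1 x.2) p := by
  have := comp_aeval_apply (fun x => conjGeneric g x.1 x.2)
    (IsScalarTower.toAlgHom K _ (RationalFunctions n K)) p
  rw [IsScalarTower.coe_toAlgHom'] at this
  rw [conjHom, this]
  congr 2
  ext x
  have e : ∀ B : Matrix (Fin n) (Fin n) K, (B.map (C (σ := Fin n × Fin n))).map
      (algebraMap _ (RationalFunctions n K)) = B.map (algebraMap K (RationalFunctions n K)) := by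
    intro B
    ext
    simp only [Matrix.map_apply]
    exact (IsScalarTower.algebraMap_apply K (MvPolynomial (Fin n × Fin n) K) _ _).symm
  rw [← e, ← e, genericMatrixRational, ← Matrix.map_mul, ← Matrix.map_mul]
  rfl

theorem det_genericMatrixRational_ne_zero : (genericMatrixRational n K).det ≠ 0 := by
  have h : algebraMap _ (RationalFunctions n K) (genericMatrix n K).det =
      (genericMatrixRational n K).det := RingHom.map_det _ _
  rw [← h]
  exact (map_ne_zero_iff _ (IsFractionRing.injective _ _)).2
    (Matrix.det_mvPolynomialX_ne_zero (Fin n) K)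

end

/-- The field generated by the polynomials `J`. -/
noncomputable def fieldOfJ {n : ℕ} (c : Composition n) (K : Type*) [Field K] :
    IntermediateField K (RationalFunctions n K) :=
  IntermediateField.adjoin K (Set.range fun p : indexSet c =>
    algebraMap (MvPolynomial (Fin n × Fin n) K) (RationalFunctions n K)
      (J K (p : Fin n × Fin n).1 (p : Fin n × Fin n).2))

section

variable {K : Type*} [Field K] {n : ℕ} (c : Composition n)

theorem algebraMap_J_mem {i j : Fin n} (hij : (i, j) ∈ indexSet c) :
    algebraMap _ (RationalFunctions n K) (J K i j) ∈ fieldOfJ c K :=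
  IntermediateField.subset_adjoin K _ ⟨⟨(i, j), hij⟩, rfl⟩

theorem exists_conj_mem_fieldOfJ : ∃ G : Matrix (Fin n) (Fin n) (RationalFunctions n K),
    IsBlockUnipotent c.index G ∧
      ∀ i j, (G⁻¹ * genericMatrixRational n K * G) i j ∈ fieldOfJ c K := by
  have hmixed : ∀ i j : Fin n, j.rev ≤ i → (mixedMatrix (genericMatrixRational n K)
      (genericMatrixRational n K).adjugate i j).det = algebraMap _ _ (J K i j) := by
    intro i j hij
    rw [J_eq_mixed hij, mixedMatrix_map]
    rfl
  refine exists_conj_mem (L := (fieldOfJ c K).toSubfield) (index_monotone c)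
    det_genericMatrixRational_ne_zero (fun i j hij => ?_) (fun i j hij => ?_) fun i q hiq hb => ?_
  · rw [hmixed i j hij]
    exact (map_ne_zero_iff _ (IsFractionRing.injective _ _)).2 (J_ne_zero hij)
  · rw [hmixed i j hij]
    exact algebraMap_J_mem c (index_monotone c hij)
  · have h : i ≤ q.rev.rev := by rwa [Fin.rev_rev]
    have e : (upperMatrix (genericMatrixRational n K) i q.rev).det =
        algebraMap _ _ (J K i q.rev) := by
      rw [J_eq_upper h, upperMatrix_map]
      rfl
    rw [e]
    refine algebraMap_J_mem c ?_
    show c.index q.rev.rev ≤ c.index i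
    rw [Fin.rev_rev, hb]

theorem fieldOfJ_le_invariantField : fieldOfJ c K ≤ invariantField c K := by
  refine IntermediateField.adjoin_le_iff.2 ?_
  rintro _ ⟨⟨⟨i, j⟩, hij⟩, rfl⟩
  refine (mem_invariantField_iff c _).2 fun g hg => ?_
  rw [conjRational_algebraMap, conjHom_J c hg hij]

theorem invariantField_le_fieldOfJ [Infinite K] : invariantField c K ≤ fieldOfJ c K := by
  intro f hf
  have hb := index_monotone c
  obtain ⟨G, hG, hS⟩ := exists_conj_mem_fieldOfJ (K := K) c
  obtain ⟨p, q, hq, rfl⟩ := IsFractionRing.div_surjective (A := MvPolynomial (Fin n × Fin n) K) f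
  have hq0 : algebraMap _ (RationalFunctions n K) q ≠ 0 :=
    (map_ne_zero_iff _ (IsFractionRing.injective _ _)).2 (nonZeroDivisors.ne_zero hq)
  refine mem_of_conj_invariant hb hG hS (p := p) (q := q)
    (by rwa [aeval_genericMatrixRational]) fun Z hZ => ?_
  let g : Matrix.GeneralLinearGroup (Fin n) K :=
    ⟨Z⁻¹, Z, hZ.inv_mul hb, hZ.mul_inv hb⟩
  have hg : g ∈ unipotentRadical c K := hZ.inv hb
  have h := (mem_invariantField_iff c _).1 hf g hg
  have e : (Z.map (algebraMap K (RationalFunctions n K))).adjugate =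
      (g : Matrix (Fin n) (Fin n) K).map (algebraMap K (RationalFunctions n K)) := by
    rw [← adjugate_map, hZ.adjugate_eq hb]
  have e' : ((g⁻¹ : Matrix.GeneralLinearGroup (Fin n) K) : Matrix (Fin n) (Fin n) K) = Z := rfl
  have hne : conjRational n K g (algebraMap _ (RationalFunctions n K) q) ≠ 0 :=
    (map_ne_zero_iff _ (conjRational n K g).injective).2 hq0
  rw [map_div₀, div_eq_iff hne, conjRational_algebraMap, conjRational_algebraMap,
    algebraMap_conjHom, algebraMap_conjHom, e', ← e] at h
  exact h

theorem algebraicIndependent_J : AlgebraicIndependent K fun p : indexSet c =>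
    algebraMap (MvPolynomial (Fin n × Fin n) K) (RationalFunctions n K)
      (J K (p : Fin n × Fin n).1 (p : Fin n × Fin n).2) := by
  classical
  have hb := index_monotone c
  obtain ⟨G, hG, hS⟩ := exists_conj_mem_fieldOfJ (K := K) c
  let y : Fin n × Fin n → RationalFunctions n K := fun p =>
    if p ∈ indexSet c then algebraMap _ (RationalFunctions n K) (J K p.1 p.2) else G p.1 p.2.rev
  have hyJ : ∀ p : indexSet c, y p = algebraMap _ (RationalFunctions n K)
      (J K (p : Fin n × Fin n).1 (p : Fin n × Fin n).2) := fun p => if_pos p.2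
  set E := IntermediateField.adjoin K (Set.range y) with hE
  have hyE : ∀ p, y p ∈ E := fun p => IntermediateField.subset_adjoin K _ ⟨p, rfl⟩
  have hle : fieldOfJ c K ≤ E := by
    refine IntermediateField.adjoin_le_iff.2 ?_
    rintro _ ⟨p, rfl⟩
    have := hyE p
    rwa [hyJ p] at this
  have hGE : ∀ i j, G i j ∈ E.toSubfield := by
    intro i j
    by_cases h : c.index j ≤ c.index i
    · rw [hG i j h, Matrix.one_apply]
      split_ifs
      · exact one_mem _
      · exact zero_mem _
    · have h1 := hyE (i, j.rev)
      have h2 : (i, j.rev) ∉ indexSet c := by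
        intro h'
        apply h
        have h'' : c.index j.rev.rev ≤ c.index i := h'
        rwa [Fin.rev_rev] at h''
      have h3 : y (i, j.rev) = G i j := by
        simp only [y, if_neg h2, Fin.rev_rev]
      rwa [h3] at h1
  have hX : ∀ i j, genericMatrixRational n K i j ∈ E := by
    have e : genericMatrixRational n K =
        G * (G⁻¹ * genericMatrixRational n K * G) * G.adjugate := by
      rw [hG.adjugate_eq hb, Matrix.mul_assoc, Matrix.mul_assoc, Matrix.mul_assoc, hG.mul_inv hb,
        mul_one, ← Matrix.mul_assoc, hG.mul_inv hb, one_mul]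
    rw [e]
    exact mul_mem_of_mem (L := E.toSubfield)
      (mul_mem_of_mem hGE fun i j => hle (hS i j)) (adjugate_mem hGE)
  have htop : E = ⊤ := by
    refine eq_top_iff.2 fun f _ => ?_
    obtain ⟨p, q, -, rfl⟩ := IsFractionRing.div_surjective (A := MvPolynomial (Fin n × Fin n) K) f
    rw [← aeval_genericMatrixRational, ← aeval_genericMatrixRational]
    exact div_mem (aeval_mem_of_mem (fun x => hX _ _) p) (aeval_mem_of_mem (fun x => hX _ _) q)
  have h := (algebraicIndependent_of_adjoin_eq_top y htop).comp
    (fun p : indexSet c => (p : Fin n × Fin n)) Subtype.val_injective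
  convert h using 1
  exact funext fun p => (hyJ p).symm

end

end ParabolicInvariants

theorem mainTheorem1 {K : Type*} [Field K] [CharZero K] {n : ℕ} (c : Composition n) :
    AlgebraicIndependent K (fun p : ParabolicInvariants.indexSet c =>
      algebraMap (MvPolynomial (Fin n × Fin n) K) (ParabolicInvariants.RationalFunctions n K)
        (ParabolicInvariants.J K (p : Fin n × Fin n).1 (p : Fin n × Fin n).2)) ∧
    IntermediateField.adjoin K (Set.range fun p : ParabolicInvariants.indexSet c =>
      algebraMap (MvPolynomial (Fin n × Fin n) K) (ParabolicInvariants.RationalFunctions n K)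
        (ParabolicInvariants.J K (p : Fin n × Fin n).1 (p : Fin n × Fin n).2)) = ParabolicInvariants.invariantField c K :=
  ⟨ParabolicInvariants.algebraicIndependent_J c,
    le_antisymm (ParabolicInvariants.fieldOfJ_le_invariantField c)
      (haveI : Infinite K := CharZero.infinite K
      ParabolicInvariants.invariantField_le_fieldOfJ c)⟩
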